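/- Let $X_1,X_2,\dots$ be independent, identically distributed real random variables, $S(0)=0$ and $S(n)=X_1+\dots+X_n$. For $x\ge 0$ put $\tau_x:=\inf\{n\ge 1:\ x+S(n)\le 0\}$, with $\inf\emptyset=\infty$. Let $U^-_0:=0$ and $U^-_{k+1}:=\inf\{n>U^-_k:\ S(n)\le S(U^-_k)\}$, $k\ge 0$, be the weak descending ladder epochs (with $U^-_{k+1}=\infty$ if $U^-_k=\infty$), and let $\chi^-_k:=S(U^-_{k-1})-S(U^-_k)\in[0,\infty)$, $k\ge1$, be the weak descending ladder heights, with $\chi^-_k:=\infty$ if $U^-_k=\infty$. Let $$H(x):=1+\sum_{m=1}^\infty \mathbf P\bigl(\chi^-_1+\dots+\chi^-_m<x\bigr)$$ be their renewal function. Assume that for some $\varrho\in(0,1)$ the sequence $n\mapsto\mathbf P(\tau_0>n)$ is regularly varying with index $-\varrho$, that is, it is positive for all large $n$ and $\mathbf P(\tau_0>\lfloor cn\rfloor)/\mathbf P(\tau_0>n)\to c^{-\varrho}$ as $n\to\infty$ for every $c>0$. Then, for every $x>0$, $H(x)$ is finite and $$\lim_{n\to\infty}\frac{\mathbf P(\tau_x>n)}{\mathbf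 P(\tau_0>n)}=H(x).$$ -/

import Mathlib

open MeasureTheory ProbabilityTheory Filter Topology
open scoped ENNReal

/-- A real sequence `a` is regularly varying (at infinity) with index `ρ`: it is eventually
positive and `a ⌊c n⌋ / a n → c ^ ρ` as `n → ∞`, for every `c > 0`. -/
def RegularlyVaryingSeq (a : ℕ → ℝ) (ρ : ℝ) : Prop :=
  (∀ᶠ n in atTop, 0 < a n) ∧
    ∀ c : ℝ, 0 < c → Tendsto (fun n : ℕ => a ⌊c * n⌋₊ / a n) atTop (𝓝 (c ^ ρ))

namespace RandomWalk

variable {Ω : Type*}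

/-- The walk `S(n) = X₁ + ⋯ + Xₙ`, `S(0) = 0`. The increment written `X_{k+1}` on paper is `X k`. -/
def walk (X : ℕ → Ω → ℝ) (n : ℕ) (ω : Ω) : ℝ := ∑ k ∈ Finset.range n, X k ω

/-- `τ_x = inf {n ≥ 1 : x + S(n) ≤ 0}`, equal to `⊤` if there is no such `n`. -/
noncomputable def exitTime (X : ℕ → Ω → ℝ) (x : ℝ) : Ω → WithTop ℕ :=
  hittingAfter (fun n ω => x + walk X n ω) (Set.Iic 0) 1

/-- Weak descending ladder epochs: `U₀ = 0` and `U_{k+1} = inf {n > U_k : S(n) ≤ S(U_k)}`,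
with value `⊤` if `U_k = ⊤` or if there is no such `n`. -/
noncomputable def ladderEpoch (X : ℕ → Ω → ℝ) : ℕ → Ω → WithTop ℕ
  | 0, _ => 0
  | k + 1, ω =>
    match ladderEpoch X k ω with
    | ⊤ => ⊤
    | (m : ℕ) => hittingAfter (walk X) (Set.Iic (walk X m ω)) (m + 1) ω

/-- Weak descending ladder heights `χ_k = S(U_{k-1}) - S(U_k) ≥ 0`; the `k`-th one on paper
is `ladderHeight X (k - 1)` here. The value is `⊤` if the epoch `U_k` is infinite. -/
noncomputable def ladderHeight (X : ℕ → Ω → ℝ) (k : ℕ) (ω : Ω) : EReal :=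
  match ladderEpoch X k ω, ladderEpoch X (k + 1) ω with
  | (i : ℕ), (j : ℕ) => ((walk X i ω - walk X j ω : ℝ) : EReal)
  | _, _ => ⊤

/-- The renewal function of the weak descending ladder heights,
`H(x) = 1 + ∑_{m ≥ 1} P(χ₁ + ⋯ + χ_m < x)`, with values in `[0, ∞]`. -/
noncomputable def renewalFunction [MeasurableSpace Ω] (μ : Measure Ω) (X : ℕ → Ω → ℝ)
    (x : ℝ) : ℝ≥0∞ :=
  1 + ∑' m : ℕ, μ {ω | ∑ k ∈ Finset.range (m + 1), ladderHeight X k ω < (x : EReal)}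

end RandomWalk

/-!
Call `j` a weak record if `S(j) ≤ S(i)` for all `i < j`. Cutting a path at its last minimum over
`[0, n]`, which is a weak record after which the walk stays strictly higher, gives the renewal
equation

`P(τ_x > n) = ∑_{j ≤ n} u_j P(τ_0 > n - j)`, `u_j = P(j is a weak record, x + S(j) > 0)`

(`RandomWalk.survival_eq_sum`). Weak records are exactly the weak descending ladder epochs, hence
`H(x) = ∑_j u_j` (`RandomWalk.renewalFunction_eq_tsum`).

*Finiteness.* With `p = P(X₁ ≥ ε) > 0` and `k ε ≥ x`, forcing the first `k` increments above `ε`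
yields `p ^ k P(τ_x > n) ≤ P(τ_0 > n)` (`RandomWalk.pow_mul_survival_le`). Since
`P(τ_0 > n - j) ≥ P(τ_0 > n)`, the renewal equation bounds all partial sums of `u` by `p ^ (-k)`.

*Asymptotics.* Write `a_n = P(τ_0 > n)` and `b_n = P(τ_x > n)`. The lower bound for `b_n / a_n`
follows at once from the monotonicity of `a`. For the upper bound the terms with `j` close to `n`
have to be controlled without any local information on `u_j`. Instead, `b` is averaged over a block
`[m, n)` with `m ≈ (1 - δ) n`: as `b` is nonincreasing,

`(n - m) b_n ≤ (n - m) H(x) a_{m - J} + (∑_{j ≥ J} u_j) ∑_{k < n} a_k`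

(`convolution_block_le`). Regular variation with index greater than `-1` gives
`∑_{k < n} a_k = O(n a_n)` (`exists_sum_range_le_mul`), so after division by `(n - m) a_n` the last
term is at most a constant times `δ⁻¹ ∑_{j ≥ J} u_j`. Letting `n → ∞`, then `J → ∞`, then `δ → 0`
gives the limit (`tendsto_convolution_div`).
-/

/-! ### Convolutions of a summable and a regularly varying sequence -/

/-- The easy half of Karamata's theorem. A ratio `a (2 n) / a n` bounded below by a constant
`q > 1 / 2` keeps the dyadic blocks of the partial sums growing geometrically, so that the last
block dominates. -/
theorem exists_sum_range_le_mul {a : ℕ → ℝ} (ha : Antitone a) (hpos : ∀ n, 0 < a n) {q : ℝ}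
    (hq : 1 / 2 < q) (h : ∀ᶠ n in atTop, q * a n ≤ a (2 * n)) :
    ∃ C : ℝ, 0 ≤ C ∧ ∀ᶠ n : ℕ in atTop, ∑ k ∈ Finset.range n, a k ≤ C * n * a n := by
  obtain ⟨N₀, hN₀⟩ := eventually_atTop.1 h
  obtain ⟨N₁, hN₁⟩ := exists_nat_ge (1 / (q - 1 / 2))
  have hq' : 0 < q - 1 / 2 := by linarith
  set N := max (max N₀ N₁) 1 with hN
  have hN0 : N₀ ≤ N := by simp [hN]
  have hN1 : N₁ ≤ N := by simp [hN]
  have hN2 : 1 ≤ N := by simp [hN]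
  -- The first term lets the doubling step close, the second one covers `N ≤ n < 2 N`.
  set C := max (1 / (q - 1 / 2)) ((∑ k ∈ Finset.range (2 * N), a k) / a (2 * N)) with hC
  have hCq : 1 ≤ C * (q - 1 / 2) := by
    rw [← div_le_iff₀ hq']; exact le_max_left _ _
  have hC0 : 0 ≤ C := le_trans (by positivity) (le_max_left _ _)
  refine ⟨C, hC0, eventually_atTop.2 ⟨N, fun n => ?_⟩⟩
  induction n using Nat.strong_induction_on with
  | _ n ih =>
    intro hn
    have hn1 : (1 : ℝ) ≤ n := by exact_mod_cast hN2.trans hn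
    rcases lt_or_ge n (2 * N) with hlt | hge
    · calc ∑ k ∈ Finset.range n, a k ≤ ∑ k ∈ Finset.range (2 * N), a k :=
            Finset.sum_le_sum_of_subset_of_nonneg (Finset.range_mono hlt.le)
              fun i _ _ => (hpos i).le
        _ ≤ C * a (2 * N) := by
            rw [← div_le_iff₀ (hpos _)]; exact le_max_right _ _
        _ ≤ C * a n := mul_le_mul_of_nonneg_left (ha hlt.le) hC0
        _ ≤ C * n * a n := by
            have := mul_le_mul_of_nonneg_left hn1 hC0
            exact mul_le_mul_of_nonneg_right (by linarith) (hpos n).le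
    · set m := (n + 1) / 2 with hm
      have hmN : N ≤ m := by omega
      have hmn : m < n := by omega
      have h2m : (2 * m : ℝ) ≤ n + 1 := by
        have : 2 * m ≤ n + 1 := by omega
        exact_mod_cast this
      have h2m' : (n : ℝ) ≤ 2 * m := by
        have : n ≤ 2 * m := by omega
        exact_mod_cast this
      have hblock : ∑ k ∈ Finset.Ico m n, a k ≤ (n - m) * a m := by
        have := Finset.sum_le_card_nsmul (Finset.Ico m n) a (a m)
          fun k hk => ha (Finset.mem_Ico.1 hk).1
        simpa [Nat.cast_sub hmn.le] using this
      have hdouble : q * a m ≤ a n := (hN₀ m (hN0.trans hmN)).trans (ha (by omega))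
      have hnq : 1 ≤ n * (q - 1 / 2) := by
        rw [← div_le_iff₀ hq']
        exact hN₁.trans (by exact_mod_cast hN1.trans hn)
      have hcoef : C * m + (n - m) ≤ C * n * q := by
        nlinarith [mul_le_mul_of_nonneg_left hnq hC0, mul_le_mul_of_nonneg_left h2m hC0,
          mul_le_mul_of_nonneg_left hCq (zero_le_one.trans hn1)]
      calc ∑ k ∈ Finset.range n, a k
          = ∑ k ∈ Finset.range m, a k + ∑ k ∈ Finset.Ico m n, a k :=
            (Finset.sum_range_add_sum_Ico a hmn.le).symm
        _ ≤ (C * m + (n - m)) * a m := by linarith [ih m hmn hmN]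
        _ ≤ C * n * q * a m := mul_le_mul_of_nonneg_right hcoef (hpos m).le
        _ = C * n * (q * a m) := by ring
        _ ≤ C * n * a n := mul_le_mul_of_nonneg_left hdouble (by positivity)

/-- Averaging a nonincreasing convolution `b = u * a` over the block `[m, n)`: the terms with
`j < J` see `a` only from the index `m - J` on, the others carry the small mass of the tail
of `u`. -/
theorem convolution_block_le {a b u : ℕ → ℝ} (ha : Antitone a) (hpos : ∀ n, 0 < a n)
    (hb : Antitone b) (hu : ∀ j, 0 ≤ u j) (hsum : Summable u)
    (hconv : ∀ n, b n = ∑ j ∈ Finset.range (n + 1), u j * a (n - j))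
    (J : ℕ) {m n : ℕ} (hmn : m ≤ n) :
    (n - m) * b n ≤ (n - m) * ((∑' j, u j) * a (m - J)) +
      (∑' j, u (j + J)) * ∑ k ∈ Finset.range n, a k := by
  set v : ℕ → ℝ := fun j => if j < J then 0 else u j with hv
  have hv0 : ∀ j, 0 ≤ v j := fun j => by simp only [hv]; split_ifs <;> simp [hu]
  have hterm : ∀ k ∈ Finset.Ico m n, b n ≤ (∑' j, u j) * a (m - J) +
      ∑ j ∈ Finset.range (k + 1), v j * a (k - j) := by
    intro k hk
    rw [Finset.mem_Ico] at hk
    calc b n ≤ b k := hb hk.2.le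
      _ = ∑ j ∈ Finset.range (k + 1), u j * a (k - j) := hconv k
      _ ≤ ∑ j ∈ Finset.range (k + 1), (u j * a (m - J) + v j * a (k - j)) := by
          refine Finset.sum_le_sum fun j _ => ?_
          by_cases hj : j < J
          · simp only [hv, hj, if_true, zero_mul, add_zero]
            exact mul_le_mul_of_nonneg_left (ha (by omega)) (hu j)
          · simp only [hv, hj, if_false]
            have := mul_nonneg (hu j) (hpos (m - J)).le
            linarith
      _ ≤ _ := by
          rw [Finset.sum_add_distrib, ← Finset.sum_mul]
          have := mul_le_mul_of_nonneg_right
            (hsum.sum_le_tsum (Finset.range (k + 1)) fun j _ => hu j) (hpos (m - J)).le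
          linarith
  have htail : ∀ l, ∑ j ∈ Finset.range l, v j ≤ ∑' j, u (j + J) := by
    intro l
    have h1 : ∑ j ∈ Finset.range l, v j ≤ ∑ j ∈ Finset.range (J + l), v j :=
      Finset.sum_le_sum_of_subset_of_nonneg (Finset.range_mono (by omega)) fun i _ _ => hv0 i
    have h2 : ∑ j ∈ Finset.range J, v j = 0 :=
      Finset.sum_eq_zero fun j hj => by simp [hv, Finset.mem_range.1 hj]
    rw [Finset.sum_range_add, h2, zero_add] at h1
    refine h1.trans ?_
    have h3 : ∀ j, v (J + j) = u (j + J) := fun j => by simp [hv, add_comm]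
    simp only [h3]
    exact ((summable_nat_add_iff J).2 hsum).sum_le_tsum _ fun j _ => hu _
  have hdouble : ∑ k ∈ Finset.Ico m n, ∑ j ∈ Finset.range (k + 1), v j * a (k - j) ≤
      (∑' j, u (j + J)) * ∑ k ∈ Finset.range n, a k := by
    calc _ ≤ ∑ k ∈ Finset.range n, ∑ j ∈ Finset.range (k + 1), v j * a (k - j) :=
          Finset.sum_le_sum_of_subset_of_nonneg
            (fun k hk => Finset.mem_range.2 (Finset.mem_Ico.1 hk).2)
            fun k _ _ => Finset.sum_nonneg fun j _ => mul_nonneg (hv0 j) (hpos _).le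
      _ = ∑ j ∈ Finset.range n, ∑ k ∈ Finset.range (n - j), v j * a k :=
          Finset.sum_range_diag_flip n fun j k => v j * a k
      _ ≤ ∑ j ∈ Finset.range n, v j * ∑ k ∈ Finset.range n, a k := by
          refine Finset.sum_le_sum fun j _ => ?_
          rw [← Finset.mul_sum]
          exact mul_le_mul_of_nonneg_left
            (Finset.sum_le_sum_of_subset_of_nonneg (Finset.range_mono (by omega))
              fun i _ _ => (hpos i).le) (hv0 j)
      _ ≤ _ := by
          rw [← Finset.sum_mul]
          exact mul_le_mul_of_nonneg_right (htail n)
            (Finset.sum_nonneg fun i _ => (hpos i).le)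
  have hall := Finset.sum_le_sum hterm
  rw [Finset.sum_add_distrib, Finset.sum_const, Finset.sum_const, Nat.card_Ico, nsmul_eq_mul,
    nsmul_eq_mul, Nat.cast_sub hmn] at hall
  linarith

/-- A nonincreasing convolution `u * a` of a summable `u ≥ 0` with a regularly varying
nonincreasing `a` of index `-ρ > -1` is asymptotic to `(∑ u) a`. Monotonicity of `u * a` takes
the place of a local bound on `u`. -/
theorem tendsto_convolution_div {a b u : ℕ → ℝ} {ρ : ℝ} (hρ : ρ < 1)
    (hreg : RegularlyVaryingSeq a (-ρ)) (ha : Antitone a) (hpos : ∀ n, 0 < a n)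
    (hb : Antitone b) (hu : ∀ j, 0 ≤ u j) (hsum : Summable u)
    (hconv : ∀ n, b n = ∑ j ∈ Finset.range (n + 1), u j * a (n - j)) :
    Tendsto (fun n => b n / a n) atTop (𝓝 (∑' j, u j)) := by
  set H := ∑' j, u j with hH
  have hH0 : 0 ≤ H := tsum_nonneg hu
  rw [Metric.tendsto_nhds]
  intro ε hε
  have hlower : ∀ᶠ n in atTop, H - ε < b n / a n := by
    obtain ⟨J, hJ⟩ := ((hsum.hasSum.tendsto_sum_nat).eventually
      (lt_mem_nhds (show H - ε < H by linarith))).exists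
    filter_upwards [eventually_ge_atTop J] with n hn
    refine hJ.trans_le ((le_div_iff₀ (hpos n)).2 ?_)
    rw [hconv, Finset.sum_mul]
    calc ∑ j ∈ Finset.range J, u j * a n ≤ ∑ j ∈ Finset.range J, u j * a (n - j) :=
          Finset.sum_le_sum fun j _ => mul_le_mul_of_nonneg_left (ha (by omega)) (hu j)
      _ ≤ _ := Finset.sum_le_sum_of_subset_of_nonneg (Finset.range_mono (by omega))
          fun j _ _ => mul_nonneg (hu j) (hpos _).le
  have hupper : ∀ᶠ n in atTop, b n / a n < H + ε := by
    obtain ⟨C, hC0, hC⟩ : ∃ C : ℝ, 0 ≤ C ∧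
        ∀ᶠ n : ℕ in atTop, ∑ k ∈ Finset.range n, a k ≤ C * n * a n := by
      have h2 : (1 / 2 : ℝ) < 2 ^ (-ρ) := by
        have : (2 : ℝ) ^ (-1 : ℝ) < 2 ^ (-ρ) :=
          Real.rpow_lt_rpow_of_exponent_lt (by norm_num) (by linarith)
        rwa [Real.rpow_neg_one, inv_eq_one_div] at this
      obtain ⟨q, hq1, hq2⟩ := exists_between h2
      refine exists_sum_range_le_mul ha hpos hq1 ?_
      filter_upwards [(hreg.2 2 two_pos).eventually (lt_mem_nhds hq2)] with n hn
      have hfl : ⌊(2 : ℝ) * n⌋₊ = 2 * n := by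
        rw [show (2 : ℝ) * n = ((2 * n : ℕ) : ℝ) by push_cast; ring, Nat.floor_natCast]
      rw [hfl, lt_div_iff₀ (hpos n)] at hn
      exact hn.le
    obtain ⟨δ, hδ0, hδ1, hδ⟩ : ∃ δ : ℝ, 0 < δ ∧ δ < 1 / 2 ∧
        H * (1 - 2 * δ) ^ (-ρ) < H + ε / 2 := by
      have hcont : ContinuousAt (fun δ : ℝ => H * (1 - 2 * δ) ^ (-ρ)) 0 := by
        refine ContinuousAt.mul continuousAt_const (ContinuousAt.rpow_const (by fun_prop) ?_)
        left; norm_num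
      have h0 : (fun δ : ℝ => H * (1 - 2 * δ) ^ (-ρ)) 0 < H + ε / 2 := by
        simp only [mul_zero, sub_zero, Real.one_rpow, mul_one]; linarith
      have h1 : ∀ᶠ δ in 𝓝[>] (0 : ℝ), H * (1 - 2 * δ) ^ (-ρ) < H + ε / 2 :=
        (hcont.eventually (gt_mem_nhds h0)).filter_mono nhdsWithin_le_nhds
      obtain ⟨δ, h, h'⟩ := (h1.and (Ioo_mem_nhdsGT (show (0 : ℝ) < 1 / 2 by norm_num))).exists
      exact ⟨δ, h'.1, h'.2, h⟩
    obtain ⟨J, hJ⟩ : ∃ J, (∑' j, u (j + J)) * (C / δ) < ε / 2 := by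
      have : Tendsto (fun J => (∑' j, u (j + J)) * (C / δ)) atTop (𝓝 (0 * (C / δ))) :=
        (tendsto_sum_nat_add u).mul_const _
      rw [zero_mul] at this
      exact (this.eventually (gt_mem_nhds (half_pos hε))).exists
    have hT0 : 0 ≤ ∑' j, u (j + J) := tsum_nonneg fun j => hu _
    have hlim : ∀ᶠ n : ℕ in atTop, H * (a ⌊(1 - 2 * δ) * n⌋₊ / a n) < H + ε / 2 :=
      (((hreg.2 (1 - 2 * δ) (by linarith)).const_mul H).eventually (gt_mem_nhds hδ))
    obtain ⟨N, hN⟩ := exists_nat_ge (J / δ)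
    filter_upwards [hC, hlim, eventually_ge_atTop (N + 1)] with n hCn hlimn hNn
    have hn0 : (0 : ℝ) < n := by exact_mod_cast (by omega : 0 < n)
    have hJn : (J : ℝ) ≤ δ * n := by
      rw [div_le_iff₀ hδ0] at hN
      have : (N : ℝ) ≤ n := by exact_mod_cast (by omega : N ≤ n)
      nlinarith
    set m := ⌊(1 - δ) * (n : ℝ)⌋₊ with hm
    have hmle : (m : ℝ) ≤ (1 - δ) * n := Nat.floor_le (by nlinarith)
    have hmn : m ≤ n := by
      have : (m : ℝ) ≤ n := by nlinarith
      exact_mod_cast this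
    have hfloor : ⌊(1 - 2 * δ) * (n : ℝ)⌋₊ ≤ m - J := by
      have h0 : 0 ≤ (1 - 2 * δ) * (n : ℝ) := mul_nonneg (by linarith) hn0.le
      have : ⌊(1 - 2 * δ) * (n : ℝ)⌋₊ + J ≤ m := by
        rw [← Nat.floor_add_natCast h0]
        exact Nat.floor_mono (by linarith)
      omega
    have hblock := convolution_block_le ha hpos hb hu hsum hconv J hmn
    have hgap : δ * n ≤ n - m := by linarith
    have hgap0 : (0 : ℝ) < n - m := (mul_pos hδ0 hn0).trans_le hgap
    have han := hpos n
    have h1 : (∑' j, u (j + J)) * ∑ k ∈ Finset.range n, a k ≤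
        (n - m) * ((∑' j, u (j + J)) * (C / δ) * a n) := by
      calc _ ≤ (∑' j, u (j + J)) * (C * n * a n) := mul_le_mul_of_nonneg_left hCn hT0
        _ = (δ * n) * ((∑' j, u (j + J)) * (C / δ) * a n) := by field_simp
        _ ≤ _ := mul_le_mul_of_nonneg_right hgap (by positivity)
    have h2 : b n ≤ H * a ⌊(1 - 2 * δ) * (n : ℝ)⌋₊ + (∑' j, u (j + J)) * (C / δ) * a n := by
      have h3 : b n ≤ H * a (m - J) + (∑' j, u (j + J)) * (C / δ) * a n := by
        refine le_of_mul_le_mul_left ?_ hgap0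
        rw [mul_add]
        linarith
      have h4 := mul_le_mul_of_nonneg_left (ha hfloor) hH0
      linarith
    rw [div_lt_iff₀ han]
    rw [← mul_div_assoc, div_lt_iff₀ han] at hlimn
    have h5 := mul_lt_mul_of_pos_right hJ han
    linarith
  filter_upwards [hlower, hupper] with n h1 h2
  rw [Real.dist_eq, abs_lt]
  constructor <;> linarith

namespace RandomWalk

variable {Ω : Type*}

/-! ### Exit times, weak records and ladder epochs along a path -/

theorem lt_exitTime_iff {X : ℕ → Ω → ℝ} {x : ℝ} {n : ℕ} {ω : Ω} :
    WithTop.some n < exitTime X x ω ↔ ∀ i, 1 ≤ i → i ≤ n → 0 < x + walk X i ω := by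
  rw [← not_le, exitTime]
  change ¬ (hittingAfter (fun n ω => x + walk X n ω) (Set.Iic 0) 1 ω ≤ WithTop.some n) ↔ _
  rw [hittingAfter_le_iff]
  simp only [Set.mem_Icc, Set.mem_Iic, not_exists, not_and, not_le, and_imp]

theorem hittingAfter_eq_coe_iff {Y : ℕ → Ω → ℝ} {s : Set ℝ} {n j : ℕ} {ω : Ω} :
    hittingAfter Y s n ω = WithTop.some j ↔
      n ≤ j ∧ Y j ω ∈ s ∧ ∀ l, n ≤ l → l < j → Y l ω ∉ s := by
  have hlt : hittingAfter Y s n ω < WithTop.some j ↔ ∃ l ∈ Set.Ico n j, Y l ω ∈ s :=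
    hittingAfter_lt_iff
  rw [le_antisymm_iff, ← not_lt (b := WithTop.some j), hlt, hittingAfter_le_iff]
  constructor
  · rintro ⟨⟨l, hl, hls⟩, h⟩
    have hlj : l = j := by
      by_contra hne
      exact h ⟨l, ⟨hl.1, lt_of_le_of_ne hl.2 hne⟩, hls⟩
    subst hlj
    exact ⟨hl.1, hls, fun k hk hkj hks => h ⟨k, ⟨hk, hkj⟩, hks⟩⟩
  · rintro ⟨hnj, hjs, h⟩
    exact ⟨⟨j, ⟨hnj, le_rfl⟩, hjs⟩, fun ⟨l, hl, hls⟩ => h l hl.1 hl.2 hls⟩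

/-- The times `j` at which the walk is weakly below its whole past. -/
def IsWeakRecord (X : ℕ → Ω → ℝ) (j : ℕ) (ω : Ω) : Prop :=
  ∀ i < j, walk X j ω ≤ walk X i ω

theorem ladderEpoch_succ_eq_coe_iff {X : ℕ → Ω → ℝ} {k j : ℕ} {ω : Ω} :
    ladderEpoch X (k + 1) ω = WithTop.some j ↔
      ∃ i < j, ladderEpoch X k ω = WithTop.some i ∧ walk X j ω ≤ walk X i ω ∧
        ∀ l, i < l → l < j → walk X i ω < walk X l ω := by
  rw [ladderEpoch]
  cases h : ladderEpoch X k ω with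
  | top => simp
  | coe m =>
    change hittingAfter (walk X) (Set.Iic (walk X m ω)) (m + 1) ω = WithTop.some j ↔ _
    rw [hittingAfter_eq_coe_iff]
    constructor
    · rintro ⟨h1, h2, h3⟩
      exact ⟨m, h1, rfl, h2, fun l hl hlj => not_le.1 (h3 l hl hlj)⟩
    · rintro ⟨i, hij, hmi, h2, h3⟩
      obtain rfl : m = i := WithTop.coe_injective hmi
      exact ⟨hij, h2, fun l hl hlj => not_le.2 (h3 l hl hlj)⟩

theorem isWeakRecord_of_ladderEpoch_eq {X : ℕ → Ω → ℝ} {ω : Ω} {k : ℕ} :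
    ∀ {j : ℕ}, ladderEpoch X k ω = WithTop.some j → IsWeakRecord X j ω := by
  induction k with
  | zero =>
    intro j h
    obtain rfl : 0 = j := WithTop.coe_injective h
    exact fun i hi => absurd hi (Nat.not_lt_zero i)
  | succ k ih =>
    intro j h l hlj
    obtain ⟨i, hij, hi, hle, hgt⟩ := ladderEpoch_succ_eq_coe_iff.1 h
    rcases lt_trichotomy l i with hli | rfl | hil
    · exact hle.trans (ih hi l hli)
    · exact hle
    · exact hle.trans (hgt l hil hlj).le

theorem lt_of_ladderEpoch_eq {X : ℕ → Ω → ℝ} {ω : Ω} {k l i : ℕ} (hkl : k < l)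
    (hi : ladderEpoch X k ω = WithTop.some i) :
    ∀ {j : ℕ}, ladderEpoch X l ω = WithTop.some j → i < j := by
  induction l, hkl using Nat.le_induction with
  | base =>
    intro j h
    obtain ⟨i', hij, hi', -⟩ := ladderEpoch_succ_eq_coe_iff.1 h
    obtain rfl : i = i' := WithTop.coe_injective (hi.symm.trans hi')
    exact hij
  | succ l _ ih =>
    intro j h
    obtain ⟨i', hij, hi', -⟩ := ladderEpoch_succ_eq_coe_iff.1 h
    exact (ih hi').trans hij

theorem eq_of_ladderEpoch_eq {X : ℕ → Ω → ℝ} {ω : Ω} {k l j : ℕ}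
    (hk : ladderEpoch X k ω = WithTop.some j) (hl : ladderEpoch X l ω = WithTop.some j) :
    k = l := by
  rcases lt_trichotomy k l with h | h | h
  · exact absurd (lt_of_ladderEpoch_eq h hk hl) (lt_irrefl j)
  · exact h
  · exact absurd (lt_of_ladderEpoch_eq h hl hk) (lt_irrefl j)

theorem exists_ladderEpoch_eq {X : ℕ → Ω → ℝ} {ω : Ω} (j : ℕ) (h : IsWeakRecord X j ω) :
    ∃ k, ladderEpoch X k ω = WithTop.some j := by
  induction j using Nat.strong_induction_on with
  | _ j ih =>
    rcases Nat.eq_zero_or_pos j with rfl | hj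
    · exact ⟨0, rfl⟩
    · classical
      -- The last weak record `i` before `j` is a ladder epoch, and `j` is the next one.
      set R := (Finset.range j).filter fun i => IsWeakRecord X i ω
      have hR : R.Nonempty :=
        ⟨0, Finset.mem_filter.2 ⟨Finset.mem_range.2 hj, fun i hi => absurd hi (Nat.not_lt_zero i)⟩⟩
      obtain ⟨hij, hi⟩ := Finset.mem_filter.1 (R.max'_mem hR)
      rw [Finset.mem_range] at hij
      set i := R.max' hR
      obtain ⟨k, hk⟩ := ih i hij hi
      refine ⟨k + 1, ?_⟩
      have hle : ladderEpoch X (k + 1) ω ≤ WithTop.some j := by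
        rw [ladderEpoch, hk]
        exact hittingAfter_le_of_mem (Nat.succ_le_of_lt hij) (h i hij)
      obtain ⟨l, hl⟩ := WithTop.ne_top_iff_exists.1 (ne_top_of_le_ne_top WithTop.coe_ne_top hle)
      have hlj : l ≤ j := by rw [← hl] at hle; exact WithTop.coe_le_coe.1 hle
      have hil : i < l := lt_of_ladderEpoch_eq (Nat.lt_succ_self k) hk hl.symm
      rcases hlj.lt_or_eq with hlt | rfl
      · have hmem : l ∈ R := Finset.mem_filter.2
          ⟨Finset.mem_range.2 hlt, isWeakRecord_of_ladderEpoch_eq hl.symm⟩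
        exact absurd (R.le_max' l hmem) (not_le.2 hil)
      · exact hl.symm

theorem sum_ladderHeight_of_eq_coe {X : ℕ → Ω → ℝ} {ω : Ω} {m : ℕ} :
    ∀ {j : ℕ}, ladderEpoch X m ω = WithTop.some j →
      ∑ k ∈ Finset.range m, ladderHeight X k ω = ((-walk X j ω : ℝ) : EReal) := by
  induction m with
  | zero =>
    intro j h
    obtain rfl : 0 = j := WithTop.coe_injective h
    simp [walk]
  | succ m ih =>
    intro j h
    obtain ⟨i, -, hi, -⟩ := ladderEpoch_succ_eq_coe_iff.1 h
    rw [Finset.sum_range_succ, ih hi, ladderHeight, hi, h, ← EReal.coe_add]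
    congr 1
    ring

theorem sum_ladderHeight_of_eq_top {X : ℕ → Ω → ℝ} {ω : Ω} {m : ℕ}
    (h : ladderEpoch X m ω = ⊤) : ∑ k ∈ Finset.range m, ladderHeight X k ω = ⊤ := by
  induction m with
  | zero => exact absurd h WithTop.zero_ne_top
  | succ m ih =>
    have hm : ladderHeight X m ω = ⊤ := by
      rw [ladderHeight, h]
      cases ladderEpoch X m ω <;> rfl
    rw [Finset.sum_range_succ, hm]
    cases h' : ladderEpoch X m ω with
    | top => rw [ih h']; rfl
    | coe j => rw [sum_ladderHeight_of_eq_coe h']; exact EReal.coe_add_top _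

theorem sum_ladderHeight_lt_iff {X : ℕ → Ω → ℝ} {ω : Ω} {m : ℕ} {x : ℝ} :
    ∑ k ∈ Finset.range m, ladderHeight X k ω < (x : EReal) ↔
      ∃ j : ℕ, ladderEpoch X m ω = WithTop.some j ∧ 0 < x + walk X j ω := by
  cases h : ladderEpoch X m ω with
  | top => rw [sum_ladderHeight_of_eq_top h]; simp
  | coe i =>
    rw [sum_ladderHeight_of_eq_coe h, EReal.coe_lt_coe_iff]
    constructor
    · exact fun hi => ⟨i, rfl, by linarith⟩
    · rintro ⟨j, hij, hj⟩
      obtain rfl : i = j := WithTop.coe_injective hij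
      linarith

/-- The last minimum over `[0, n]` splits the path: it is a weak record, and the walk stays
strictly above it afterwards. -/
theorem lt_exitTime_iff_exists_isWeakRecord {X : ℕ → Ω → ℝ} {x : ℝ} (hx : 0 < x) {n : ℕ} {ω : Ω} :
    WithTop.some n < exitTime X x ω ↔
      ∃ j ∈ Finset.range (n + 1), (IsWeakRecord X j ω ∧ 0 < x + walk X j ω) ∧
        ∀ i, 1 ≤ i → i ≤ n - j → walk X j ω < walk X (j + i) ω := by
  rw [lt_exitTime_iff]
  constructor
  · intro h
    -- Minimising lexicographically, with time reversed, selects the last minimum.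
    obtain ⟨j, hj, hmin⟩ := Finset.exists_min_image (Finset.range (n + 1))
      (fun i => toLex (walk X i ω, OrderDual.toDual i)) ⟨0, by simp⟩
    simp only [Prod.Lex.toLex_le_toLex, OrderDual.toDual_le_toDual] at hmin
    rw [Finset.mem_range] at hj
    refine ⟨j, Finset.mem_range.2 hj, ⟨fun i hi => ?_, ?_⟩, fun i hi hin => ?_⟩
    · rcases hmin i (Finset.mem_range.2 (hi.trans hj)) with h1 | h1
      · exact h1.le
      · exact h1.1.le
    · rcases Nat.eq_zero_or_pos j with rfl | hj0
      · simpa [walk] using hx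
      · exact h j hj0 (by omega)
    · rcases hmin (j + i) (Finset.mem_range.2 (by omega)) with h1 | h1
      · exact h1
      · have := h1.2
        omega
  · rintro ⟨j, hj, ⟨hrec, hpos⟩, hafter⟩ i - hin
    rw [Finset.mem_range] at hj
    rcases lt_trichotomy i j with hij | rfl | hji
    · linarith [hrec i hij]
    · exact hpos
    · have := hafter (i - j) (by omega) (by omega)
      rw [Nat.add_sub_cancel' hji.le] at this
      linarith

/-! ### Independence of the past and the shifted walk -/

theorem walk_add_sub (X : ℕ → Ω → ℝ) (j i : ℕ) (ω : Ω) :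
    walk X (j + i) ω - walk X j ω = ∑ l ∈ Finset.range i, X (j + l) ω := by
  rw [walk, walk, Finset.sum_range_add, add_sub_cancel_left]

theorem measurable_walk_of_le {m : MeasurableSpace Ω} {X : ℕ → Ω → ℝ} {i j : ℕ} (hij : i ≤ j)
    (hX : ∀ l < j, Measurable (X l)) : Measurable (walk X i) :=
  Finset.measurable_fun_sum _ fun l hl => hX l ((Finset.mem_range.1 hl).trans_le hij)

theorem measurableSet_isWeakRecord {m : MeasurableSpace Ω} {X : ℕ → Ω → ℝ} {j : ℕ}
    (hX : ∀ l < j, Measurable (X l)) (x : ℝ) :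
    MeasurableSet {ω | IsWeakRecord X j ω ∧ 0 < x + walk X j ω} := by
  have hj := measurable_walk_of_le le_rfl hX
  refine MeasurableSet.inter ?_ (measurableSet_lt measurable_const (measurable_const.add hj))
  have hrec : {ω | IsWeakRecord X j ω} = ⋂ i, ⋂ (_ : i < j), {ω | walk X j ω ≤ walk X i ω} := by
    ext ω
    simp [IsWeakRecord]
  change MeasurableSet {ω | IsWeakRecord X j ω}
  rw [hrec]
  exact MeasurableSet.iInter fun i => MeasurableSet.iInter fun hi =>
    measurableSet_le hj (measurable_walk_of_le hi.le hX)

theorem measurable_of_lt_iSup_comap (X : ℕ → Ω → ℝ) {l j : ℕ} (hl : l < j) :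
    Measurable[⨆ i ∈ Set.Iio j, MeasurableSpace.comap (X i) inferInstance] (X l) :=
  Measurable.of_comap_le
    (le_iSup₂_of_le (f := fun i _ => MeasurableSpace.comap (X i) inferInstance)
      l (Set.mem_Iio.2 hl) le_rfl)

theorem measurableSet_preimage_sequence {m : MeasurableSpace Ω} {Y : ℕ → Ω → ℝ}
    (hY : ∀ i, Measurable (Y i)) {B : Set (ℕ → ℝ)} (hB : MeasurableSet B) :
    MeasurableSet ((fun ω i => Y i ω) ⁻¹' B) :=
  measurable_pi_iff.2 hY hB

variable [MeasurableSpace Ω] {μ : Measure Ω} [IsProbabilityMeasure μ] {X : ℕ → Ω → ℝ}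

theorem map_shift_eq (hX : ∀ k, Measurable (X k)) (hindep : iIndepFun X μ)
    (hident : ∀ k, IdentDistrib (X k) (X 0) μ μ) (j : ℕ) :
    μ.map (fun ω i => X (j + i) ω) = μ.map (fun ω i => X i ω) := by
  have hshift : iIndepFun (fun i => X (j + i)) μ := hindep.precomp (add_right_injective j)
  rw [(iIndepFun_iff_map_fun_eq_infinitePi_map (fun i => hX (j + i))).1 hshift,
    (iIndepFun_iff_map_fun_eq_infinitePi_map hX).1 hindep]
  congr 1
  funext i
  rw [(hident (j + i)).map_eq, (hident i).map_eq]

/-- The Markov property at the fixed time `j`: whether the walk restarted at time `j` from the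
level `z` survives `k` steps is independent of the first `j` increments. -/
theorem measureReal_inter_survival (hX : ∀ k, Measurable (X k)) (hindep : iIndepFun X μ)
    (hident : ∀ k, IdentDistrib (X k) (X 0) μ μ) {j : ℕ} {E : Set Ω}
    (hE : MeasurableSet[⨆ i ∈ Set.Iio j, MeasurableSpace.comap (X i) inferInstance] E)
    (z : ℝ) (k : ℕ) :
    μ.real (E ∩ {ω | ∀ i, 1 ≤ i → i ≤ k → 0 < z + (walk X (j + i) ω - walk X j ω)}) =
      μ.real E * μ.real {ω | WithTop.some k < exitTime X z ω} := by
  set B : Set (ℕ → ℝ) := {y | ∀ i, 1 ≤ i → i ≤ k → 0 < z + ∑ l ∈ Finset.range i, y l} with hB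
  have hBm : MeasurableSet B := by
    simp only [hB, Set.ofPred_forall]
    refine MeasurableSet.iInter fun i => MeasurableSet.iInter fun _ => MeasurableSet.iInter fun _ =>
      measurableSet_lt measurable_const ?_
    fun_prop
  have hset : {ω | ∀ i, 1 ≤ i → i ≤ k → 0 < z + (walk X (j + i) ω - walk X j ω)} =
      (fun ω i => X (j + i) ω) ⁻¹' B := by
    ext ω
    simp only [walk_add_sub, hB, Set.mem_ofPred_eq, Set.mem_preimage]
  have hset0 : {ω | WithTop.some k < exitTime X z ω} = (fun ω i => X i ω) ⁻¹' B := by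
    ext ω
    simp only [lt_exitTime_iff, walk, hB, Set.mem_ofPred_eq, Set.mem_preimage]
  have hfut : MeasurableSet[⨆ i ∈ Set.Ici j, MeasurableSpace.comap (X i) inferInstance]
      ((fun ω i => X (j + i) ω) ⁻¹' B) := by
    refine measurableSet_preimage_sequence (fun i => ?_) hBm
    exact Measurable.of_comap_le
      (le_iSup₂_of_le (f := fun i _ => MeasurableSpace.comap (X i) inferInstance)
        (j + i) (Set.mem_Ici.2 (Nat.le_add_right j i)) le_rfl)
  have hind := indep_iSup_of_disjoint (fun i => (hX i).comap_le) hindep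
    (show Disjoint (Set.Iio j) (Set.Ici j) from Set.disjoint_left.2 fun i h1 h2 =>
      absurd (Set.mem_Ici.1 h2) (not_le.2 (Set.mem_Iio.1 h1)))
  have hmul := (Indep_iff _ _ μ).1 hind E _ hE hfut
  have hlaw : μ ((fun ω i => X (j + i) ω) ⁻¹' B) = μ ((fun ω i => X i ω) ⁻¹' B) := by
    rw [← Measure.map_apply (measurable_pi_iff.2 fun i => hX (j + i)) hBm,
      ← Measure.map_apply (measurable_pi_iff.2 hX) hBm, map_shift_eq hX hindep hident]
  rw [hset, hset0, measureReal_def, hmul, hlaw, ENNReal.toReal_mul]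
  rfl

theorem survival_antitone (μ : Measure Ω) [IsProbabilityMeasure μ] (X : ℕ → Ω → ℝ) (x : ℝ) :
    Antitone fun n : ℕ => μ.real {ω | WithTop.some n < exitTime X x ω} :=
  fun _ _ hmn => measureReal_mono fun _ hω => (WithTop.coe_le_coe.2 hmn).trans_lt hω

theorem survival_mono_start (μ : Measure Ω) [IsProbabilityMeasure μ] (X : ℕ → Ω → ℝ) (n : ℕ)
    {x y : ℝ} (hxy : x ≤ y) :
    μ.real {ω | WithTop.some n < exitTime X x ω} ≤
      μ.real {ω | WithTop.some n < exitTime X y ω} := by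
  refine measureReal_mono fun ω hω => ?_
  simp only [Set.mem_ofPred_eq, lt_exitTime_iff] at hω ⊢
  exact fun i h1 hi => (hω i h1 hi).trans_le (by linarith)

/-! ### Survival probabilities -/

/-- The renewal equation `P(τ_x > n) = ∑_{j ≤ n} P(j is a weak record, x + S(j) > 0) P(τ_0 > n - j)`,
obtained by conditioning on the last minimum of the walk over `[0, n]`. -/
theorem survival_eq_sum (hX : ∀ k, Measurable (X k)) (hindep : iIndepFun X μ)
    (hident : ∀ k, IdentDistrib (X k) (X 0) μ μ) {x : ℝ} (hx : 0 < x) (n : ℕ) :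
    μ.real {ω | WithTop.some n < exitTime X x ω} =
      ∑ j ∈ Finset.range (n + 1), μ.real {ω | IsWeakRecord X j ω ∧ 0 < x + walk X j ω} *
        μ.real {ω | WithTop.some (n - j) < exitTime X 0 ω} := by
  set A : ℕ → Set Ω := fun j => {ω | IsWeakRecord X j ω ∧ 0 < x + walk X j ω} ∩
    {ω | ∀ i, 1 ≤ i → i ≤ n - j → 0 < 0 + (walk X (j + i) ω - walk X j ω)} with hA
  have hunion : {ω | WithTop.some n < exitTime X x ω} = ⋃ j ∈ Finset.range (n + 1), A j := by
    ext ω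
    simp only [Set.mem_ofPred_eq, lt_exitTime_iff_exists_isWeakRecord hx, hA, Set.mem_iUnion,
      Set.mem_inter_iff, zero_add, sub_pos, exists_prop]
  have hmeas : ∀ j, Measurable (walk X j) := fun j => measurable_walk_of_le le_rfl fun l _ => hX l
  have hAm : ∀ j ∈ Finset.range (n + 1), MeasurableSet (A j) := by
    intro j _
    refine (measurableSet_isWeakRecord (fun l _ => hX l) x).inter ?_
    simp only [Set.ofPred_forall]
    exact MeasurableSet.iInter fun i => MeasurableSet.iInter fun _ => MeasurableSet.iInter fun _ =>
      measurableSet_lt measurable_const (measurable_const.add ((hmeas _).sub (hmeas _)))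
  have hdisj : ∀ i j, i < j → j ≤ n → Disjoint (A i) (A j) := by
    intro i j hij hjn
    refine Set.disjoint_left.2 fun ω hi hj => ?_
    have h1 := hi.2 (j - i) (by omega) (by omega)
    have h2 := hj.1.1 i hij
    rw [Nat.add_sub_cancel' hij.le] at h1
    linarith
  rw [hunion, measureReal_biUnion_finset ?_ hAm]
  · exact Finset.sum_congr rfl fun j _ => measureReal_inter_survival hX hindep hident
      (measurableSet_isWeakRecord (fun l hl => measurable_of_lt_iSup_comap X hl) x) 0 (n - j)
  · intro i hi j hj hij
    simp only [Finset.coe_range, Set.mem_Iio] at hi hj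
    rcases lt_or_gt_of_ne hij with h | h
    · exact hdisj i j h (by omega)
    · exact (hdisj j i h (by omega)).symm

/-- Letting the first `k` increments exceed `ε` lifts the walk above `k ε`. -/
theorem pow_mul_survival_le (hX : ∀ k, Measurable (X k)) (hindep : iIndepFun X μ)
    (hident : ∀ k, IdentDistrib (X k) (X 0) μ μ) {ε : ℝ} (hε : 0 < ε) (k n : ℕ) :
    μ.real {ω | ε ≤ X 0 ω} ^ k * μ.real {ω | WithTop.some n < exitTime X (k * ε) ω} ≤
      μ.real {ω | WithTop.some (n + k) < exitTime X 0 ω} := by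
  have hstep : ∀ (y : ℝ), 0 ≤ y → ∀ n : ℕ,
      μ.real {ω | ε ≤ X 0 ω} * μ.real {ω | WithTop.some n < exitTime X (y + ε) ω} ≤
        μ.real {ω | WithTop.some (n + 1) < exitTime X y ω} := by
    intro y hy n
    have hE : MeasurableSet[⨆ i ∈ Set.Iio 1, MeasurableSpace.comap (X i) inferInstance]
        {ω | ε ≤ X 0 ω} :=
      measurable_of_lt_iSup_comap X Nat.zero_lt_one measurableSet_Ici
    rw [← measureReal_inter_survival hX hindep hident hE]
    refine measureReal_mono fun ω hω => ?_
    have h0 : ε ≤ X 0 ω := hω.1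
    have h1 : walk X 1 ω = X 0 ω := by simp [walk]
    simp only [Set.mem_ofPred_eq, lt_exitTime_iff]
    intro i hi hin
    obtain ⟨l, rfl⟩ := Nat.exists_eq_add_of_le hi
    rcases Nat.eq_zero_or_pos l with rfl | hl
    · rw [add_zero, h1]
      linarith
    · have := hω.2 l hl (by omega)
      linarith
  induction k generalizing n with
  | zero => simp
  | succ k ih =>
    calc _ = μ.real {ω | ε ≤ X 0 ω} ^ k * (μ.real {ω | ε ≤ X 0 ω} *
          μ.real {ω | WithTop.some n < exitTime X (k * ε + ε) ω}) := by
          rw [pow_succ, mul_assoc, show ((k + 1 : ℕ) : ℝ) * ε = k * ε + ε by push_cast; ring]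
      _ ≤ μ.real {ω | ε ≤ X 0 ω} ^ k *
          μ.real {ω | WithTop.some (n + 1) < exitTime X (k * ε) ω} :=
          mul_le_mul_of_nonneg_left (hstep _ (by positivity) n) (by positivity)
      _ ≤ _ := by
          have := ih (n + 1)
          rwa [show n + 1 + k = n + (k + 1) by omega] at this

theorem exists_pos_measureReal_le (h : 0 < μ.real {ω | WithTop.some 1 < exitTime X 0 ω}) :
    ∃ ε : ℝ, 0 < ε ∧ 0 < μ.real {ω | ε ≤ X 0 ω} := by
  by_contra! hcon
  have hsub : {ω | WithTop.some 1 < exitTime X 0 ω} ⊆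
      ⋃ n : ℕ, {ω | (1 : ℝ) / (n + 1) ≤ X 0 ω} := by
    intro ω hω
    have h1 := lt_exitTime_iff.1 hω 1 le_rfl le_rfl
    simp only [walk, Finset.range_one, Finset.sum_singleton, zero_add] at h1
    obtain ⟨n, hn⟩ := exists_nat_one_div_lt h1
    exact Set.mem_iUnion.2 ⟨n, hn.le⟩
  have hzero : μ (⋃ n : ℕ, {ω | (1 : ℝ) / (n + 1) ≤ X 0 ω}) = 0 := by
    refine measure_iUnion_null fun n => ?_
    have := le_antisymm (hcon (1 / (n + 1)) (by positivity)) measureReal_nonneg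
    exact (measureReal_eq_zero_iff).1 this
  rw [measureReal_def, measure_mono_null hsub hzero] at h
  simp at h

theorem exists_survival_le_mul (hX : ∀ k, Measurable (X k)) (hindep : iIndepFun X μ)
    (hident : ∀ k, IdentDistrib (X k) (X 0) μ μ)
    (h : 0 < μ.real {ω | WithTop.some 1 < exitTime X 0 ω}) (x : ℝ) :
    ∃ K : ℝ, ∀ n : ℕ, μ.real {ω | WithTop.some n < exitTime X x ω} ≤
      K * μ.real {ω | WithTop.some n < exitTime X 0 ω} := by
  obtain ⟨ε, hε, hp⟩ := exists_pos_measureReal_le h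
  obtain ⟨k, hk⟩ := exists_nat_ge (x / ε)
  rw [div_le_iff₀ hε] at hk
  refine ⟨(μ.real {ω | ε ≤ X 0 ω} ^ k)⁻¹, fun n => ?_⟩
  rw [← div_eq_inv_mul, le_div_iff₀ (pow_pos hp k), mul_comm]
  calc _ ≤ μ.real {ω | ε ≤ X 0 ω} ^ k * μ.real {ω | WithTop.some n < exitTime X (k * ε) ω} :=
        mul_le_mul_of_nonneg_left (survival_mono_start μ X n hk) (pow_pos hp k).le
    _ ≤ _ := pow_mul_survival_le hX hindep hident hε k n
    _ ≤ _ := survival_antitone μ X 0 (Nat.le_add_right n k)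

theorem summable_measureReal_isWeakRecord (hX : ∀ k, Measurable (X k)) (hindep : iIndepFun X μ)
    (hident : ∀ k, IdentDistrib (X k) (X 0) μ μ)
    (hpos : ∀ n : ℕ, 0 < μ.real {ω | WithTop.some n < exitTime X 0 ω}) {x : ℝ} (hx : 0 < x) :
    Summable fun j => μ.real {ω | IsWeakRecord X j ω ∧ 0 < x + walk X j ω} := by
  obtain ⟨K, hK⟩ := exists_survival_le_mul hX hindep hident (hpos 1) x
  refine summable_of_sum_range_le (c := K) (fun j => measureReal_nonneg) fun n => ?_
  refine le_of_mul_le_mul_right ?_ (hpos n)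
  calc _ = ∑ j ∈ Finset.range n, μ.real {ω | IsWeakRecord X j ω ∧ 0 < x + walk X j ω} *
        μ.real {ω | WithTop.some n < exitTime X 0 ω} := Finset.sum_mul ..
    _ ≤ ∑ j ∈ Finset.range n, μ.real {ω | IsWeakRecord X j ω ∧ 0 < x + walk X j ω} *
        μ.real {ω | WithTop.some (n - j) < exitTime X 0 ω} :=
        Finset.sum_le_sum fun j _ => mul_le_mul_of_nonneg_left
          (survival_antitone μ X 0 (Nat.sub_le n j)) measureReal_nonneg
    _ ≤ _ := Finset.sum_le_sum_of_subset_of_nonneg (Finset.range_mono (Nat.le_succ n))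
        fun j _ _ => mul_nonneg measureReal_nonneg measureReal_nonneg
    _ = _ := (survival_eq_sum hX hindep hident hx n).symm
    _ ≤ _ := hK n

/-! ### The renewal function as a sum over weak records -/

theorem measurableSet_ladderEpoch_eq (hX : ∀ k, Measurable (X k)) (k : ℕ) :
    ∀ j : ℕ, MeasurableSet {ω | ladderEpoch X k ω = WithTop.some j} := by
  have hmeas : ∀ j, Measurable (walk X j) := fun j => measurable_walk_of_le le_rfl fun l _ => hX l
  induction k with
  | zero => exact fun j => MeasurableSet.const ((0 : WithTop ℕ) = WithTop.some j)
  | succ k ih =>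
    intro j
    simp only [ladderEpoch_succ_eq_coe_iff]
    refine measurableSet_setOfPred.2 ?_
    refine Measurable.exists fun i => (Measurable.and measurable_const ?_)
    refine (measurableSet_setOfPred.1 (ih i)).and ?_
    refine (measurableSet_setOfPred.1 (measurableSet_le (hmeas j) (hmeas i))).and ?_
    exact Measurable.forall fun l => measurable_const.imp (measurable_const.imp
      (measurableSet_setOfPred.1 (measurableSet_lt (hmeas i) (hmeas l))))

/-- The renewal function counts ladder epochs before the walk drops by `x`; sorting them by their
position in time instead of by their rank gives a sum over weak records. -/
theorem renewalFunction_eq_tsum (hX : ∀ k, Measurable (X k)) {x : ℝ} (hx : 0 < x) :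
    renewalFunction μ X x = ∑' j, μ {ω | IsWeakRecord X j ω ∧ 0 < x + walk X j ω} := by
  have hmeas : ∀ j, Measurable (walk X j) := fun j => measurable_walk_of_le le_rfl fun l _ => hX l
  set A : ℕ → ℕ → Set Ω := fun m j =>
    {ω | ladderEpoch X m ω = WithTop.some j ∧ 0 < x + walk X j ω} with hA
  have hAm : ∀ m j, MeasurableSet (A m j) := fun m j =>
    (measurableSet_ladderEpoch_eq hX m j).inter
      (measurableSet_lt measurable_const (measurable_const.add (hmeas j)))
  have hrank : ∀ m, μ {ω | ∑ k ∈ Finset.range m, ladderHeight X k ω < (x : EReal)} =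
      ∑' j, μ (A m j) := by
    intro m
    rw [← measure_iUnion ?_ (hAm m)]
    · congr 1
      ext ω
      simp only [sum_ladderHeight_lt_iff, hA, Set.mem_ofPred_eq, Set.mem_iUnion]
    · intro i j hij
      exact Set.disjoint_left.2 fun ω hi hj => hij (WithTop.coe_injective (hi.1.symm.trans hj.1))
  have hposition : ∀ j, μ {ω | IsWeakRecord X j ω ∧ 0 < x + walk X j ω} = ∑' m, μ (A m j) := by
    intro j
    rw [← measure_iUnion ?_ fun m => hAm m j]
    · congr 1
      ext ω
      simp only [hA, Set.mem_ofPred_eq, Set.mem_iUnion]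
      constructor
      · rintro ⟨h1, h2⟩
        obtain ⟨m, hm⟩ := exists_ladderEpoch_eq j h1
        exact ⟨m, hm, h2⟩
      · rintro ⟨m, hm, h2⟩
        exact ⟨isWeakRecord_of_ladderEpoch_eq hm, h2⟩
    · intro k l hkl
      exact Set.disjoint_left.2 fun ω hk hl => hkl (eq_of_ladderEpoch_eq hk.1 hl.1)
  simp only [hposition]
  rw [ENNReal.tsum_comm]
  simp only [← hrank]
  rw [tsum_eq_zero_add' ENNReal.summable, renewalFunction]
  congr 1
  simp [hx]

end RandomWalk

theorem mainTheorem9 {Ω : Type*} [MeasurableSpace Ω] (μ : Measure Ω) [IsProbabilityMeasure μ]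
    (X : ℕ → Ω → ℝ) (hX : ∀ k, Measurable (X k)) (hindep : iIndepFun X μ)
    (hident : ∀ k, IdentDistrib (X k) (X 0) μ μ)
    (ρ : ℝ) (hρ0 : 0 < ρ) (hρ1 : ρ < 1)
    (hreg : RegularlyVaryingSeq (fun n : ℕ => μ.real {ω | WithTop.some n < RandomWalk.exitTime X 0 ω}) (-ρ))
    (x : ℝ) (hx : 0 < x) :
    RandomWalk.renewalFunction μ X x < ⊤ ∧
      Tendsto
        (fun n : ℕ => μ.real {ω | WithTop.some n < RandomWalk.exitTime X x ω} /
          μ.real {ω | WithTop.some n < RandomWalk.exitTime X 0 ω})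
        atTop (𝓝 (RandomWalk.renewalFunction μ X x).toReal) := by
  have hanti := RandomWalk.survival_antitone μ X 0
  have hpos : ∀ n : ℕ, 0 < μ.real {ω | WithTop.some n < RandomWalk.exitTime X 0 ω} := by
    intro n
    obtain ⟨m, hm, hnm⟩ := (hreg.1.and (eventually_ge_atTop n)).exists
    exact hm.trans_le (hanti hnm)
  have hsum := RandomWalk.summable_measureReal_isWeakRecord hX hindep hident hpos hx
  have hH : RandomWalk.renewalFunction μ X x = ENNReal.ofReal
      (∑' j, μ.real {ω | RandomWalk.IsWeakRecord X j ω ∧ 0 < x + RandomWalk.walk X j ω}) := by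
    rw [RandomWalk.renewalFunction_eq_tsum hX hx,
      ENNReal.ofReal_tsum_of_nonneg (fun j => measureReal_nonneg) hsum]
    exact tsum_congr fun j => (ofReal_measureReal).symm
  rw [hH, ENNReal.toReal_ofReal (tsum_nonneg fun j => measureReal_nonneg)]
  exact ⟨ENNReal.ofReal_lt_top, tendsto_convolution_div hρ1 hreg hanti hpos
    (RandomWalk.survival_antitone μ X x) (fun j => measureReal_nonneg) hsum
    (RandomWalk.survival_eq_sum hX hindep hident hx)⟩
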